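/- All graphs are finite, simple and connected. A graph $G$ is locally linear if for every vertex $v$ the subgraph of $G$ induced by the neighbourhood of $v$ is a path (with at least one vertex). For every integer $n \ge 12$, the minimum number of edges of a nonhamiltonian locally linear graph with $n$ vertices is exactly $2n$; that is, such graphs with $n$ vertices exist, each of them has at least $2n$ edges, and some one of them has exactly $2n$ edges. Moreover, for every $n \ge 3$, every nonhamiltonian locally linear graph with $n$ vertices has at least $2n$ edges. -/

import Mathlib

/-- `G` is locally linear: the neighbourhood of every vertex induces a path
(a path graph on at least one vertex). -/
def SimpleGraph.IsLocallyLinear {V : Type*} (G : SimpleGraph V) : Prop :=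
  ∀ v : V, ∃ k : ℕ,
    Nonempty (G.induce (G.neighborSet v) ≃g SimpleGraph.pathGraph (k + 1))

/-- The numbers of edges of the connected nonhamiltonian locally linear graphs of order `n`. -/
def nonhamiltonianLocallyLinearSizes (n : ℕ) : Set ℕ :=
  {m : ℕ | ∃ G : SimpleGraph (Fin n),
    G.Connected ∧ G.IsLocallyLinear ∧ ¬ G.IsHamiltonian ∧ G.edgeSet.ncard = m}

open Finset

namespace SimpleGraph

open Matrix

variable {V : Type*} {G : SimpleGraph V}

/-! Since every link is a path, the triangles form a surface with boundary on which every vertex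
lies on the boundary. With at least three vertices, each vertex has exactly two boundary edges,
leading to the two ends of its link. So `G.boundary` is a 2-factor, and if it is connected it is a
Hamiltonian cycle.

Otherwise the surface has at least two boundary curves, which forces V - E + T ≤ 0 for the numbers
of vertices, edges and triangles. This is proved by linear algebra mod 2: split the boundary curves
into two classes and close each class with one cap. The vertex-edge matrix has rank at least V - 1,
the edge-face matrix has rank at least (T + 2) - 1, and their product vanishes, so V + T ≤ E. Each
degree exceeds the number of triangles at the vertex by one, so 2E = 3T + V. Eliminating T gives E ≥
2V (`two_mul_card_le_of_separated`).

For sharpness, take an annulus with an ear on each edge of one boundary 4-cycle: the four ears see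
only four vertices, which blocks a Hamiltonian cycle (`not_isHamiltonian_of_card_le`). Further ears
on the other boundary cycle each add one vertex and two edges (`exists_annulus`). -/

/-- The neighbours of `v` are `f 0, …, f k`, without repetition, and induce a path in this order. -/
structure IsLinearAt (G : SimpleGraph V) (v : V) (k : ℕ) (f : ℕ → V) : Prop where
  adj_iff : ∀ x, G.Adj v x ↔ ∃ i ≤ k, f i = x
  inj : ∀ i ≤ k, ∀ j ≤ k, f i = f j → i = j
  path : ∀ i ≤ k, ∀ j ≤ k, (G.Adj (f i) (f j) ↔ i + 1 = j ∨ j + 1 = i)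

theorem isLocallyLinear_iff : G.IsLocallyLinear ↔ ∀ v, ∃ k f, G.IsLinearAt v k f := by
  refine forall_congr' fun v ↦ exists_congr fun k ↦ ⟨?_, ?_⟩
  · rintro ⟨e⟩
    have he (i j : Fin (k + 1)) :
        G.Adj (e.symm i) (e.symm j) ↔ i.val + 1 = j ∨ j.val + 1 = i := by
      rw [← pathGraph_adj, ← e.symm.map_adj_iff]; rfl
    have key (i : ℕ) (hi : i ≤ k) : Fin.ofNat (k + 1) i = ⟨i, by omega⟩ := by
      ext; simp [Fin.ofNat, Nat.mod_eq_of_lt (Nat.lt_succ_of_le hi)]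
    refine ⟨fun i ↦ e.symm (Fin.ofNat (k + 1) i), ?_, ?_, ?_⟩
    · intro x
      constructor
      · intro hx
        refine ⟨e ⟨x, hx⟩, by omega, ?_⟩
        rw [key _ (by omega)]
        simp
      · rintro ⟨i, -, rfl⟩
        exact (e.symm _).2
    · intro i hi j hj h
      have := e.symm.injective (Subtype.ext h)
      rw [key i hi, key j hj] at this
      simpa using this
    · intro i hi j hj
      rw [key i hi, key j hj, he]
  · rintro ⟨f, hf⟩
    refine ⟨(RelIso.symm ⟨Equiv.ofBijective
      (fun i : Fin (k + 1) ↦ (⟨f i, (hf.adj_iff _).2 ⟨i, by omega, rfl⟩⟩ : G.neighborSet v))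
      ⟨?_, ?_⟩, ?_⟩)⟩
    · intro i j h
      exact Fin.ext (hf.inj _ (by omega) _ (by omega) (congrArg Subtype.val h))
    · rintro ⟨x, hx⟩
      obtain ⟨i, hi, rfl⟩ := (hf.adj_iff x).1 hx
      exact ⟨⟨i, by omega⟩, rfl⟩
    · intro i j
      rw [pathGraph_adj]
      exact hf.path _ (by omega) _ (by omega)

namespace IsLinearAt

variable {v : V} {k : ℕ} {f : ℕ → V}

theorem adj (h : G.IsLinearAt v k f) {i : ℕ} (hi : i ≤ k) : G.Adj v (f i) :=
  (h.adj_iff _).2 ⟨i, hi, rfl⟩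

theorem adj_succ (h : G.IsLinearAt v k f) {i : ℕ} (hi : i + 1 ≤ k) : G.Adj (f i) (f (i + 1)) :=
  (h.path _ (by omega) _ hi).2 (Or.inl rfl)

theorem mem_commonNeighbors_iff (h : G.IsLinearAt v k f) {i : ℕ} (hi : i ≤ k) (x : V) :
    x ∈ G.commonNeighbors v (f i) ↔ ∃ j ≤ k, (i + 1 = j ∨ j + 1 = i) ∧ f j = x := by
  rw [mem_commonNeighbors, h.adj_iff]
  constructor
  · rintro ⟨⟨j, hj, rfl⟩, ha⟩
    exact ⟨j, hj, (h.path i hi j hj).1 ha, rfl⟩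
  · rintro ⟨j, hj, hij, rfl⟩
    exact ⟨⟨j, hj, rfl⟩, (h.path i hi j hj).2 hij⟩

theorem commonNeighbors_first (h : G.IsLinearAt v k f) (hk : 1 ≤ k) :
    G.commonNeighbors v (f 0) = {f 1} := by
  ext x
  rw [h.mem_commonNeighbors_iff (by omega)]
  constructor
  · rintro ⟨j, hj, hij, rfl⟩
    obtain rfl : j = 1 := by omega
    rfl
  · rintro rfl
    exact ⟨1, hk, by omega, rfl⟩

theorem commonNeighbors_last (h : G.IsLinearAt v (k + 1) f) :
    G.commonNeighbors v (f (k + 1)) = {f k} := by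
  ext x
  rw [h.mem_commonNeighbors_iff (by omega)]
  constructor
  · rintro ⟨j, hj, hij, rfl⟩
    obtain rfl : j = k := by omega
    rfl
  · rintro rfl
    exact ⟨k, by omega, by omega, rfl⟩

theorem commonNeighbors_inner (h : G.IsLinearAt v k f) {i : ℕ} (hi : i + 2 ≤ k) :
    G.commonNeighbors v (f (i + 1)) = {f i, f (i + 2)} := by
  ext x
  rw [h.mem_commonNeighbors_iff (by omega)]
  constructor
  · rintro ⟨j, hj, hij, rfl⟩
    obtain rfl | rfl : j = i ∨ j = i + 2 := by omega
    · simp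
    · simp
  · rintro (rfl | rfl)
    · exact ⟨i, by omega, by omega, rfl⟩
    · exact ⟨i + 2, by omega, by omega, rfl⟩

theorem ne_inner (h : G.IsLinearAt v k f) {i : ℕ} (hi : i + 2 ≤ k) : f i ≠ f (i + 2) := by
  intro e
  have := h.inj _ (by omega) _ (by omega) e
  omega

end IsLinearAt

/-! ### Boundary edges and vertex degrees -/

/-- The edges of `G` that lie in exactly one triangle. -/
def boundary (G : SimpleGraph V) : SimpleGraph V where
  Adj u v := G.Adj u v ∧ (G.commonNeighbors u v).ncard = 1
  symm := ⟨fun u v h ↦ ⟨h.1.symm, by rw [commonNeighbors_symm]; exact h.2⟩⟩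
  loopless := ⟨fun u h ↦ G.loopless.irrefl u h.1⟩

theorem boundary_le : G.boundary ≤ G := fun _ _ h ↦ h.1

namespace IsLinearAt

variable {v : V} {k : ℕ} {f : ℕ → V}

theorem boundary_adj_iff (h : G.IsLinearAt v k f) (hk : 1 ≤ k) (x : V) :
    G.boundary.Adj v x ↔ x = f 0 ∨ x = f k := by
  constructor
  · rintro ⟨ha, hc⟩
    obtain ⟨i, hi, rfl⟩ := (h.adj_iff x).1 ha
    by_contra! hne
    obtain ⟨i, rfl⟩ : ∃ j, i = j + 1 := Nat.exists_eq_succ_of_ne_zero (by rintro rfl; simp at hne)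
    have hik : i + 2 ≤ k := by
      have : i + 1 ≠ k := by rintro rfl; simp at hne
      omega
    rw [h.commonNeighbors_inner hik, Set.ncard_pair (h.ne_inner hik)] at hc
    omega
  · rintro (rfl | rfl)
    · exact ⟨h.adj (by omega), by rw [h.commonNeighbors_first hk, Set.ncard_singleton]⟩
    · obtain ⟨k, rfl⟩ := Nat.exists_eq_add_of_le' hk
      exact ⟨h.adj le_rfl, by rw [h.commonNeighbors_last, Set.ncard_singleton]⟩

theorem ncard_boundary (h : G.IsLinearAt v k f) (hk : 1 ≤ k) :
    (G.boundary.neighborSet v).ncard = 2 := by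
  have : G.boundary.neighborSet v = {f 0, f k} := by
    ext x
    exact h.boundary_adj_iff hk x
  rw [this, Set.ncard_pair]
  intro e
  have := h.inj _ (by omega) _ (by omega) e
  omega

theorem ncard_neighborSet (h : G.IsLinearAt v k f) : (G.neighborSet v).ncard = k + 1 := by
  have : G.neighborSet v = f '' (Finset.range (k + 1) : Set ℕ) := by
    ext x
    simp only [mem_neighborSet, h.adj_iff, Set.mem_image, Finset.coe_range, Set.mem_Iio,
      Nat.lt_succ_iff]
  rw [this, Set.InjOn.ncard_image, Set.ncard_coe_finset, Finset.card_range]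
  intro i hi j hj
  simp only [Finset.coe_range, Set.mem_Iio] at hi hj
  exact h.inj i (by omega) j (by omega)

/-- In a connected graph with at least three vertices no vertex has degree one. -/
theorem one_le [Fintype V] (hG : G.Connected) (hV : 3 ≤ Fintype.card V)
    (hl : ∀ v, ∃ k f, G.IsLinearAt v k f) (h : G.IsLinearAt v k f) : 1 ≤ k := by
  classical
  by_contra! hk
  obtain rfl : k = 0 := by omega
  have hv (x : V) (hx : G.Adj v x) : x = f 0 := by
    obtain ⟨i, hi, rfl⟩ := (h.adj_iff x).1 hx
    rw [Nat.le_zero.1 hi]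
  obtain ⟨l, g, hg⟩ := hl (f 0)
  obtain ⟨i, hi, hiv⟩ := (hg.adj_iff v).1 (h.adj le_rfl).symm
  -- `v` and `f 0` have no common neighbour, so `v` is isolated in the path around `f 0`. That path
  -- is then the single vertex `v`, and `{v, f 0}` is a whole component.
  have hl0 : l = 0 := by
    by_contra hl0
    obtain ⟨j, hj, hij⟩ : ∃ j ≤ l, i + 1 = j ∨ j + 1 = i := by
      by_cases hil : i = l
      · exact ⟨i - 1, by omega, by omega⟩
      · exact ⟨i + 1, by omega, by omega⟩
    have h1 := (hg.path i hi j hj).2 hij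
    rw [hiv] at h1
    exact (hg.adj hj).ne (hv _ h1).symm
  subst hl0
  have hx (x : V) (hx : G.Adj (f 0) x) : x = v := by
    obtain ⟨j, hj, rfl⟩ := (hg.adj_iff x).1 hx
    rw [← hiv]; congr 1; omega
  have hwalk {x y : V} (p : G.Walk x y) (hy : y = v) : x = v ∨ x = f 0 := by
    induction p with
    | nil => exact Or.inl hy
    | cons ha _ ih =>
      rcases ih hy with rfl | rfl
      · exact Or.inr (hv _ ha.symm)
      · exact Or.inl (hx _ ha.symm)
  have hall (x : V) : x = v ∨ x = f 0 :=
    (hG.preconnected x v).elim fun p ↦ hwalk p rfl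
  have : (univ : Finset V) ⊆ {v, f 0} := by
    intro x _
    simpa using hall x
  have h2 := (Finset.card_le_card this).trans Finset.card_le_two
  rw [Finset.card_univ] at h2
  omega

end IsLinearAt

/-! ### Rank bounds and counting of triangles -/

/-- Rank-nullity: the kernel lies in the line spanned by the all-ones vector. -/
theorem _root_.Matrix.card_le_rank_add_one {m n K : Type*} [Fintype m] [Fintype n] [Field K]
    (M : Matrix m n K) (h : ∀ x, M *ᵥ x = 0 → ∀ i j, x i = x j) :
    Fintype.card n ≤ M.rank + 1 := by
  have h1 := LinearMap.finrank_range_add_finrank_ker M.mulVecLin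
  have h2 : LinearMap.ker M.mulVecLin ≤ Submodule.span K {(1 : n → K)} := by
    intro x hx
    have hx := h x hx
    rw [Submodule.mem_span_singleton]
    rcases isEmpty_or_nonempty n with hn | ⟨⟨i⟩⟩
    · exact ⟨0, Subsingleton.elim _ _⟩
    · exact ⟨x i, funext fun j ↦ by simpa using hx i j⟩
  have h3 := (Submodule.finrank_mono h2).trans (finrank_span_le_card _)
  rw [Module.finrank_fintype_fun_eq_card] at h1
  simp only [Set.toFinset_singleton, Finset.card_singleton] at h3
  rw [Matrix.rank]
  omega

theorem sum_edgeSet_ite_mem [Fintype V] [DecidableEq V] [DecidableRel G.Adj] {M : Type*}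
    [AddCommMonoid M] (v : V) (φ : Sym2 V → M) :
    ∑ e : G.edgeSet, (if v ∈ e.1 then φ e.1 else 0) = ∑ w ∈ G.neighborFinset v, φ s(v, w) := by
  have h : G.edgeFinset.filter (v ∈ ·) = (G.neighborFinset v).image (s(v, ·)) := by
    ext e
    induction e with | _ a b => ?_
    simp only [Finset.mem_filter, mem_edgeFinset, mem_edgeSet, Sym2.mem_iff, Finset.mem_image,
      mem_neighborFinset, Sym2.eq_iff]
    constructor
    · rintro ⟨hab, rfl | rfl⟩
      · exact ⟨b, hab, by simp⟩
      · exact ⟨a, hab.symm, by simp⟩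
    · rintro ⟨w, hw, ⟨rfl, rfl⟩ | ⟨rfl, rfl⟩⟩
      · exact ⟨hw, by simp⟩
      · exact ⟨hw.symm, by simp⟩
  rw [← Finset.sum_subtype G.edgeFinset (fun e ↦ mem_edgeFinset)
    (fun e ↦ if v ∈ e then φ e else 0), ← Finset.sum_filter, h, Finset.sum_image]
  intro a _ b _ hab
  exact Sym2.congr_right.1 hab

theorem triangle_filter_eq [Fintype V] [DecidableEq V] [DecidableRel G.Adj] {v x : V}
    (h : G.Adj v x) :
    (G.cliqueFinset 3).filter (fun t ↦ v ∈ t ∧ x ∈ t) =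
      (G.commonNeighbors v x).toFinset.image (fun c ↦ {v, x, c}) := by
  ext t
  simp only [Finset.mem_filter, mem_cliqueFinset_iff, Finset.mem_image, Set.mem_toFinset,
    SimpleGraph.mem_commonNeighbors]
  constructor
  · rintro ⟨ht, hv, hx⟩
    obtain ⟨c, hc⟩ : ∃ c, (t.erase v).erase x = {c} := by
      rw [← Finset.card_eq_one, Finset.card_erase_of_mem (Finset.mem_erase.2 ⟨h.ne', hx⟩),
        Finset.card_erase_of_mem hv, ht.card_eq]
    have hct : c ∈ (t.erase v).erase x := by rw [hc]; simp
    simp only [Finset.mem_erase] at hct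
    refine ⟨c, ⟨ht.isClique hv hct.2.2 hct.2.1.symm, ht.isClique hx hct.2.2 hct.1.symm⟩, ?_⟩
    rw [← hc, Finset.insert_erase (Finset.mem_erase.2 ⟨h.ne', hx⟩), Finset.insert_erase hv]
  · rintro ⟨c, ⟨h1, h2⟩, rfl⟩
    exact ⟨is3Clique_triple_iff.2 ⟨h, h1, h2⟩, by simp, by simp⟩

theorem sum_triangle_filter [Fintype V] [DecidableEq V] [DecidableRel G.Adj] {M : Type*}
    [AddCommMonoid M] {v x : V} (h : G.Adj v x) (g : Finset V → M) :
    ∑ t ∈ (G.cliqueFinset 3).filter (fun t ↦ v ∈ t ∧ x ∈ t), g t =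
      ∑ c ∈ (G.commonNeighbors v x).toFinset, g {v, x, c} := by
  rw [triangle_filter_eq h, Finset.sum_image]
  intro a ha b hb hab
  simp only [Finset.mem_coe, Set.mem_toFinset, SimpleGraph.mem_commonNeighbors] at ha hb
  have : a ∈ ({v, x, b} : Finset V) := by
    rw [← show ({v, x, a} : Finset V) = {v, x, b} from hab]; simp
  simp only [Finset.mem_insert, Finset.mem_singleton] at this
  rcases this with rfl | rfl | rfl
  · exact absurd rfl ha.1.ne
  · exact absurd rfl ha.2.ne
  · rfl

namespace IsLinearAt

variable {v : V} {k : ℕ} {f : ℕ → V}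

theorem mem_triangle_iff [DecidableEq V] (h : G.IsLinearAt v k f) (t : Finset V) :
    (G.IsNClique 3 t ∧ v ∈ t) ↔ ∃ i < k, {v, f i, f (i + 1)} = t := by
  constructor
  · rintro ⟨ht, hv⟩
    obtain ⟨a, b, hab, he⟩ := Finset.card_eq_two.1
      (show (t.erase v).card = 2 by rw [Finset.card_erase_of_mem hv, ht.card_eq])
    have ht' : t = {v, a, b} := by rw [← he, Finset.insert_erase hv]
    subst ht'
    obtain ⟨h1, h2, h3⟩ := is3Clique_triple_iff.1 ht
    obtain ⟨i, hi, rfl⟩ := (h.adj_iff a).1 h1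
    obtain ⟨j, hj, rfl⟩ := (h.adj_iff b).1 h2
    rcases (h.path i hi j hj).1 h3 with rfl | rfl
    · exact ⟨i, by omega, rfl⟩
    · exact ⟨j, by omega, by rw [Finset.pair_comm]⟩
  · rintro ⟨i, hi, rfl⟩
    exact ⟨is3Clique_triple_iff.2 ⟨h.adj (by omega), h.adj (by omega), h.adj_succ (by omega)⟩,
      by simp⟩

theorem card_triangles [Fintype V] [DecidableEq V] [DecidableRel G.Adj]
    (h : G.IsLinearAt v k f) : ((G.cliqueFinset 3).filter (v ∈ ·)).card = k := by
  have : (G.cliqueFinset 3).filter (v ∈ ·) =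
      (Finset.range k).image (fun i ↦ {v, f i, f (i + 1)}) := by
    ext t
    simp only [Finset.mem_filter, mem_cliqueFinset_iff, Finset.mem_image, Finset.mem_range]
    exact h.mem_triangle_iff t
  rw [this, Finset.card_image_of_injOn, Finset.card_range]
  have key {i j : ℕ} (hi : i < k) (hj : j < k)
      (hij : ({v, f i, f (i + 1)} : Finset V) = {v, f j, f (j + 1)}) : j ≤ i := by
    have : f i ∈ ({v, f j, f (j + 1)} : Finset V) := by rw [← hij]; simp
    simp only [Finset.mem_insert, Finset.mem_singleton] at this
    rcases this with e | e | e
    · exact absurd e (h.adj (by omega)).ne'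
    · exact (h.inj _ (by omega) _ (by omega) e).ge
    · have := h.inj _ (by omega) _ (by omega) e
      omega
  intro i hi j hj hij
  simp only [Finset.coe_range, Set.mem_Iio] at hi hj
  exact le_antisymm (key hj hi hij.symm) (key hi hj hij)

end IsLinearAt

/-- The triangles at a vertex are the edges of its link, one fewer than its neighbours. Summing over
all vertices counts each triangle three times. -/
theorem two_mul_card_edgeFinset_eq [Fintype V] [DecidableEq V] [DecidableRel G.Adj]
    (hl : ∀ v, ∃ k f, G.IsLinearAt v k f) :
    2 * G.edgeFinset.card = 3 * (G.cliqueFinset 3).card + Fintype.card V := by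
  rw [← sum_degrees_eq_twice_card_edges]
  have h1 (v : V) : G.degree v = ((G.cliqueFinset 3).filter (v ∈ ·)).card + 1 := by
    obtain ⟨k, f, h⟩ := hl v
    rw [h.card_triangles, ← h.ncard_neighborSet, ← card_neighborFinset_eq_degree,
      ← Set.ncard_coe_finset, coe_neighborFinset]
  simp_rw [h1]
  rw [Finset.sum_add_distrib]
  have h2 := sum_card_bipartiteAbove_eq_sum_card_bipartiteBelow (s := univ)
    (t := G.cliqueFinset 3) (fun (v : V) t ↦ v ∈ t)
  simp only [bipartiteAbove, bipartiteBelow] at h2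
  rw [h2, Finset.sum_congr rfl (g := fun _ ↦ 3)]
  · simp [mul_comm]
  · intro t ht
    rw [Finset.filter_univ_mem, (mem_cliqueFinset_iff.1 ht).card_eq]

/-! ### The Euler characteristic bound modulo 2 -/

section Separated

variable [Fintype V] [DecidableEq V] [DecidableRel G.Adj]

/-- The vertex-edge incidence matrix modulo 2. -/
def vertexEdge (G : SimpleGraph V) : Matrix V G.edgeSet (ZMod 2) :=
  .of fun v e ↦ if v ∈ e.1 then 1 else 0

/-- The edge-face incidence matrix modulo 2, where the faces are the triangles and two caps, which
are bounded by the boundary edges inside `S` and outside `S`. -/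
def edgeFace (G : SimpleGraph V) [DecidableRel G.Adj] [DecidableRel G.boundary.Adj]
    (S : Set V) [DecidablePred (· ∈ S)] :
    Matrix G.edgeSet ({t // t ∈ G.cliqueFinset 3} ⊕ Bool) (ZMod 2) :=
  .of fun e ↦ Sum.elim (fun t ↦ if ∀ x ∈ e.1, x ∈ t.1 then 1 else 0)
    (fun b ↦ if e.1 ∈ G.boundary.edgeSet ∧ ∀ x ∈ e.1, (x ∈ S ↔ b = true) then 1 else 0)

/-- A vector killed by the transpose takes equal values at the two ends of each edge, so
connectedness makes it constant. -/
theorem card_le_rank_vertexEdge_add_one (hG : G.Connected) :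
    Fintype.card V ≤ (vertexEdge G).rank + 1 := by
  rw [← Matrix.rank_transpose]
  refine Matrix.card_le_rank_add_one _ fun x hx i j ↦ ?_
  obtain ⟨p⟩ := hG.preconnected i j
  induction p with
  | nil => rfl
  | @cons u w _ ha _ ih =>
    rw [← ih]
    have h := congrFun hx ⟨s(u, w), ha⟩
    simp only [Matrix.mulVec, dotProduct, Matrix.transpose_apply, vertexEdge, Matrix.of_apply,
      Sym2.mem_iff, Pi.zero_apply, ite_mul, one_mul, zero_mul] at h
    rw [← Finset.sum_filter] at h
    have h2 : (univ.filter fun a ↦ a = u ∨ a = w) = {u, w} := by ext; simp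
    rw [h2, Finset.sum_pair ha.ne] at h
    exact CharTwo.add_eq_zero.1 h

variable [DecidableRel G.boundary.Adj]

/-- Every face boundary is a cycle mod 2: a vertex meets two or none of the edges of a triangle, and
its two boundary edges belong to the same cap by `hS`. -/
theorem vertexEdge_mul_edgeFace {S : Set V} [DecidablePred (· ∈ S)]
    (hS : ∀ u v, G.boundary.Adj u v → (u ∈ S ↔ v ∈ S))
    (hB : ∀ v, (G.boundary.neighborSet v).ncard = 2) : vertexEdge G * edgeFace G S = 0 := by
  have h2 : ((2 : ℕ) : ZMod 2) = 0 := by decide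
  ext v t
  rw [Matrix.mul_apply]
  simp only [vertexEdge, Matrix.of_apply, ite_mul, one_mul, zero_mul, Matrix.zero_apply]
  rcases t with t | b
  · simp only [edgeFace, Matrix.of_apply, Sum.elim_inl]
    rw [sum_edgeSet_ite_mem v (fun e ↦ if ∀ x ∈ e, x ∈ t.1 then (1 : ZMod 2) else 0)]
    rw [Finset.sum_boole]
    by_cases hv : v ∈ t.1
    · have ht := mem_cliqueFinset_iff.1 t.2
      have : (G.neighborFinset v).filter (fun w ↦ ∀ x ∈ s(v, w), x ∈ t.1) = t.1.erase v := by
        ext w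
        simp only [Finset.mem_filter, mem_neighborFinset, Sym2.mem_iff, forall_eq_or_imp,
          forall_eq, Finset.mem_erase, hv, true_and]
        exact ⟨fun h ↦ ⟨h.1.ne', h.2⟩, fun h ↦ ⟨ht.isClique hv h.2 h.1.symm, h.2⟩⟩
      rw [this, Finset.card_erase_of_mem hv, ht.card_eq]
      exact h2
    · rw [Finset.filter_eq_empty_iff.2]
      · simp
      · intro w _ h
        exact hv (h v (by simp))
  · simp only [edgeFace, Matrix.of_apply, Sum.elim_inr]
    rw [sum_edgeSet_ite_mem v (fun e ↦ if e ∈ G.boundary.edgeSet ∧ ∀ x ∈ e, (x ∈ S ↔ b = true)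
      then (1 : ZMod 2) else 0)]
    rw [Finset.sum_boole]
    by_cases hv : v ∈ S ↔ b = true
    · have : (((G.neighborFinset v).filter fun w ↦ s(v, w) ∈ G.boundary.edgeSet ∧
          ∀ x ∈ s(v, w), (x ∈ S ↔ b = true) : Finset V) : Set V) = G.boundary.neighborSet v := by
        ext w
        simp only [Finset.coe_filter, mem_neighborFinset, Sym2.mem_iff, forall_eq_or_imp,
          forall_eq, hv, true_and, mem_edgeSet, Set.mem_ofPred_eq, mem_neighborSet]
        exact ⟨fun h ↦ h.2.1, fun h ↦ ⟨h.1, h, (hS v w h).symm.trans hv⟩⟩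
      rw [← Set.ncard_coe_finset, this, hB]
      exact h2
    · rw [Finset.filter_eq_empty_iff.2]
      · simp
      · intro w _ h
        exact hv (h.2 v (by simp))

/-- In the capped complex every edge lies on exactly two faces, so a kernel vector agrees on faces
sharing an edge. Connectedness of `G` then makes it constant on all faces, both caps included. -/
theorem card_le_rank_edgeFace_add_one (hG : G.Connected) {S : Set V} [DecidablePred (· ∈ S)]
    (hl : ∀ v, ∃ k f, 1 ≤ k ∧ G.IsLinearAt v k f) (hne : S.Nonempty) (hne' : Sᶜ.Nonempty)
    (hS : ∀ u v, G.boundary.Adj u v → (u ∈ S ↔ v ∈ S)) :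
    (G.cliqueFinset 3).card + 2 ≤ (edgeFace G S).rank + 1 := by
  have hc : Fintype.card ({t // t ∈ G.cliqueFinset 3} ⊕ Bool) = (G.cliqueFinset 3).card + 2 := by
    rw [Fintype.card_sum, Fintype.card_coe, Fintype.card_bool]
  rw [← hc]
  refine Matrix.card_le_rank_add_one _ fun y hy ↦ ?_
  let g : Finset V → ZMod 2 := fun t ↦ if h : t ∈ G.cliqueFinset 3 then y (.inl ⟨t, h⟩) else 0
  have hg (t : {t // t ∈ G.cliqueFinset 3}) : y (.inl t) = g t.1 := by
    simp only [g, t.2, dif_pos]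
  let τ : V → ZMod 2 := fun v ↦ y (.inr (decide (v ∈ S)))
  have edge_eq {v x : V} (h : G.Adj v x) : ∑ c ∈ (G.commonNeighbors v x).toFinset, g {v, x, c} +
      (if G.boundary.Adj v x then τ v else 0) = 0 := by
    have h0 := congrFun hy ⟨s(v, x), h⟩
    simp only [Matrix.mulVec, dotProduct, edgeFace, Matrix.of_apply, Fintype.sum_sum_type,
      Sum.elim_inl, Sum.elim_inr, ite_mul, one_mul, zero_mul, Pi.zero_apply, Sym2.mem_iff,
      forall_eq_or_imp, forall_eq, mem_edgeSet, hg] at h0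
    rw [Finset.sum_coe_sort (G.cliqueFinset 3) (fun t ↦ if v ∈ t ∧ x ∈ t then g t else 0),
      ← Finset.sum_filter, sum_triangle_filter h] at h0
    refine Eq.trans ?_ h0
    congr 1
    by_cases hb : G.boundary.Adj v x
    · have := hS v x hb
      by_cases hv : v ∈ S
      · simp [hb, τ, hv, this.1 hv]
      · simp [hb, τ, hv, mt this.2 hv]
    · simp [hb]
  -- Walk through the fan of triangles at `v`: the first one borders the cap along the boundary edge
  -- to `f 0`, and consecutive ones share an inner edge.
  have tri {v : V} {t : Finset V} (ht : G.IsNClique 3 t) (hv : v ∈ t) : g t = τ v := by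
    obtain ⟨k, f, hk, h⟩ := hl v
    obtain ⟨i, hi, rfl⟩ := (h.mem_triangle_iff t).1 ⟨ht, hv⟩
    clear hv ht
    induction i with
    | zero =>
      have h1 := edge_eq (h.adj (Nat.zero_le k))
      rw [if_pos ((h.boundary_adj_iff hk _).2 (Or.inl rfl))] at h1
      simp only [h.commonNeighbors_first hk, Set.toFinset_singleton, Finset.sum_singleton] at h1
      exact CharTwo.add_eq_zero.1 h1
    | succ i ih =>
      rw [← ih (by omega)]
      have h1 := edge_eq (h.adj (i := i + 1) (by omega))
      rw [if_neg] at h1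
      · simp only [h.commonNeighbors_inner (i := i) (by omega), Set.toFinset_insert,
          Set.toFinset_singleton] at h1
        rw [Finset.sum_pair (h.ne_inner (by omega)), add_zero] at h1
        rw [← CharTwo.add_eq_zero.1 h1, Finset.pair_comm]
      · rw [h.boundary_adj_iff hk]
        rintro (e | e)
        · have := h.inj _ (by omega) _ (by omega) e
          omega
        · have := h.inj _ (by omega) _ (by omega) e
          omega
  -- Adjacent vertices lie in a common triangle, whose value equals the cap value of each.
  have hτ (v w : V) : τ v = τ w := by
    obtain ⟨p⟩ := hG.preconnected v w
    induction p with
    | nil => rfl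
    | @cons u w _ ha _ ih =>
      rw [← ih]
      obtain ⟨k, f, hk, h⟩ := hl u
      obtain ⟨c, hc⟩ : ∃ c, c ∈ G.commonNeighbors u w := by
        obtain ⟨i, hi, rfl⟩ := (h.adj_iff w).1 ha
        rcases i with _ | i
        · exact ⟨f 1, by rw [h.commonNeighbors_first hk]; rfl⟩
        · exact ⟨f i, (h.mem_commonNeighbors_iff hi _).2 ⟨i, by omega, by omega, rfl⟩⟩
      have ht := is3Clique_triple_iff.2 ⟨ha, hc.1, hc.2⟩
      rw [← tri ht (v := u) (by simp), ← tri ht (v := w) (by simp)]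
  obtain ⟨s, hs⟩ := hne
  obtain ⟨s', hs'⟩ := hne'
  have hy (j) : y j = τ s := by
    rcases j with t | b
    · have ht := mem_cliqueFinset_iff.1 t.2
      obtain ⟨v, hv⟩ : t.1.Nonempty := Finset.card_pos.1 (by rw [ht.card_eq]; omega)
      rw [hg, tri ht hv, hτ]
    · cases b
      · rw [hτ s s']
        simp only [τ, show s' ∉ S from hs', decide_false]
      · simp only [τ, hs, decide_true]
  intro i j
  rw [hy i, hy j]

end Separated

/-- If the boundary graph of a connected locally linear graph is separated by a set of vertices,
then the graph has at least `2 * n` edges. -/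
theorem two_mul_card_le_of_separated [Fintype V] (hG : G.Connected)
    (hl : ∀ v, ∃ k f, 1 ≤ k ∧ G.IsLinearAt v k f) {S : Set V} (hne : S.Nonempty)
    (hne' : Sᶜ.Nonempty) (hS : ∀ u v, G.boundary.Adj u v → (u ∈ S ↔ v ∈ S)) :
    2 * Fintype.card V ≤ G.edgeSet.ncard := by
  classical
  have h1 := card_le_rank_vertexEdge_add_one hG
  have h2 := card_le_rank_edgeFace_add_one hG hl hne hne' hS
  have h3 := Matrix.rank_add_rank_le_card_of_mul_eq_zero
    (vertexEdge_mul_edgeFace hS fun v ↦ by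
      obtain ⟨k, f, hk, h⟩ := hl v
      exact h.ncard_boundary hk)
  have h4 := two_mul_card_edgeFinset_eq fun v ↦ by
    obtain ⟨k, f, -, h⟩ := hl v
    exact ⟨k, f, h⟩
  rw [← Set.toFinset_card, ← edgeFinset] at h3
  rw [← coe_edgeFinset, Set.ncard_coe_finset]
  omega

/-! ### The lower bound -/

theorem isHamiltonian_of_connected_of_ncard_neighborSet [Fintype V] [DecidableEq V] {H : SimpleGraph V} (hHG : H ≤ G)
    (hH : H.Connected) (h2 : ∀ v, (H.neighborSet v).ncard = 2) : G.IsHamiltonian := by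
  refine IsHamiltonian.mono hHG fun _ ↦ ?_
  obtain ⟨v⟩ := hH.nonempty
  have hc : H.IsCycles := fun v _ ↦ h2 v
  obtain ⟨p, hp, hs⟩ := hc.exists_cycle_toSubgraph_verts_eq_connectedComponentSupp
    (c := H.connectedComponentMk v) (v := v) rfl
    (Set.nonempty_of_ncard_ne_zero (by rw [h2]; omega))
  refine ⟨v, p, hp, hp.isPath_tail.isHamiltonian_of_mem fun w ↦ ?_⟩
  have hw : w ∈ p.support := by
    rw [← Walk.mem_verts_toSubgraph, hs, ConnectedComponent.mem_supp_iff, ConnectedComponent.eq]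
    exact hH.preconnected w v
  rw [Walk.support_tail_of_not_nil p hp.not_nil]
  rw [Walk.mem_support_iff] at hw
  rcases hw with rfl | hw
  · exact Walk.end_mem_tail_support hp.not_nil
  · exact hw

theorem IsLocallyLinear.two_mul_card_le [Fintype V] [DecidableEq V] (hl : G.IsLocallyLinear)
    (hG : G.Connected) (hV : 3 ≤ Fintype.card V) (hH : ¬ G.IsHamiltonian) :
    2 * Fintype.card V ≤ G.edgeSet.ncard := by
  rw [isLocallyLinear_iff] at hl
  have hl' (v : V) : ∃ k f, 1 ≤ k ∧ G.IsLinearAt v k f := by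
    obtain ⟨k, f, h⟩ := hl v
    exact ⟨k, f, h.one_le hG hV hl, h⟩
  by_contra hlt
  refine hH (isHamiltonian_of_connected_of_ncard_neighborSet boundary_le ?_ fun v ↦ ?_)
  · have := hG.nonempty
    refine ⟨fun u w ↦ ?_⟩
    by_contra huw
    -- The separating set is one component of the boundary graph.
    refine hlt (two_mul_card_le_of_separated hG hl' (S := {x | G.boundary.Reachable u x})
      ⟨u, Reachable.refl u⟩ ⟨w, huw⟩ fun a b hab ↦ ?_)
    exact ⟨fun h ↦ h.trans hab.reachable, fun h ↦ h.trans hab.symm.reachable⟩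
  · obtain ⟨k, f, hk, h⟩ := hl' v
    exact h.ncard_boundary hk

/-! ### An obstruction to Hamiltonian cycles -/

/-- A Hamiltonian cycle yields a transitive permutation along edges. -/
theorem IsHamiltonian.exists_perm [Fintype V] [DecidableEq V] (h : G.IsHamiltonian)
    (hV : Fintype.card V ≠ 1) : ∃ σ : Equiv.Perm V, (∀ x, G.Adj x (σ x)) ∧
      ∀ S : Set V, S.Nonempty → (∀ x ∈ S, σ x ∈ S) → S = Set.univ := by
  obtain ⟨a, p, hp⟩ := h hV
  have hnil := hp.isCycle.not_nil
  -- The base point occurs at both ends of the closed walk; without its first occurrence every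
  -- vertex is listed once.
  set l := p.support.tail with hl
  have hnd : l.Nodup := hp.isCycle.support_nodup
  have hmem (x : V) : x ∈ l := by
    rw [hl, ← Walk.support_tail_of_not_nil p hnil]
    exact hp.isHamiltonian_tail.mem_support x
  have hlen : l.length = p.length := by simp [hl]
  have h3 := hp.isCycle.three_le_length
  have hget (i : ℕ) (hi : i < l.length) : l[i] = p.getVert (i + 1) := by
    simp only [hl, List.getElem_tail]
    rw [Walk.support_getElem_eq_getVert]
  refine ⟨l.formPerm, fun x ↦ ?_, fun S ⟨x, hx⟩ hS ↦ Set.eq_univ_of_forall fun y ↦ ?_⟩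
  · obtain ⟨i, hi, rfl⟩ := List.getElem_of_mem (hmem x)
    rw [List.formPerm_apply_getElem _ hnd, hget, hget]
    by_cases hil : i + 1 < l.length
    · rw [Nat.mod_eq_of_lt hil]
      exact p.adj_getVert_succ (by omega)
    · obtain hil : i + 1 = l.length := by omega
      rw [hil, Nat.mod_self, hlen, Walk.getVert_length]
      have := p.adj_getVert_succ (i := 0) (by omega)
      rwa [Walk.getVert_zero] at this
  · obtain ⟨n, rfl⟩ := (hnd.isCycleOn_formPerm.2 (hmem x) (hmem y)).exists_nat_pow_eq
    induction n with
    | zero => exact hx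
    | succ n ih =>
      rw [pow_succ']
      exact hS _ ih

/-- A graph with a set `A` of vertices all of whose neighbours lie in a set `C` that is not larger
than `A` is nonhamiltonian, unless `A` and `C` cover all vertices. -/
theorem not_isHamiltonian_of_card_le [Fintype V] [DecidableEq V] {A C : Finset V}
    (hA : A.Nonempty) (hC : C.card ≤ A.card) (hAC : ∀ a ∈ A, ∀ c, G.Adj a c → c ∈ C)
    {z : V} (hzA : z ∉ A) (hzC : z ∉ C) : ¬ G.IsHamiltonian := by
  intro h
  obtain ⟨a, ha⟩ := hA
  obtain ⟨σ, hσ, ht⟩ := h.exists_perm fun hV ↦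
    hzA (by rwa [(Fintype.card_le_one_iff.1 hV.le) z a])
  -- Predecessors of `A` lie in `C`, and by cardinality they fill it. So `σ` maps `C` into `A` as
  -- well as `A` into `C`, and the invariant set `A ∪ C` would have to contain `z`.
  have h2 : A.image σ.symm = C := by
    refine Finset.eq_of_subset_of_card_le ?_ (by
      rwa [Finset.card_image_of_injective _ σ.symm.injective])
    refine Finset.image_subset_iff.2 fun x hx ↦ hAC x hx _ ?_
    have := (hσ (σ.symm x)).symm
    rwa [σ.apply_symm_apply] at this
  have hz : z ∈ (A ∪ C : Finset V) := by
    have := ht (A ∪ C : Finset V) ⟨a, by simp [ha]⟩ fun x ↦ ?_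
    · exact Finset.mem_coe.1 (this ▸ Set.mem_univ z)
    · intro hx
      rcases Finset.mem_union.1 (Finset.mem_coe.1 hx) with hx | hx
      · exact Finset.mem_coe.2 (Finset.mem_union_right _ (hAC x hx _ (hσ x)))
      · obtain ⟨y, hy, rfl⟩ := Finset.mem_image.1 (h2 ▸ hx)
        simp [hy]
  simp [hzA, hzC] at hz

/-! ### Attaching ears -/

/-- The graph obtained from `G` by adding a new vertex with the neighbours `u` and `v`. -/
def ear (G : SimpleGraph V) (u v : V) : SimpleGraph (Option V) where
  Adj
    | some x, some y => G.Adj x y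
    | some x, none => x = u ∨ x = v
    | none, some y => y = u ∨ y = v
    | none, none => False
  symm := ⟨by
    rintro (_ | x) (_ | y) h
    · exact h
    · exact h
    · exact h
    · exact G.symm.symm _ _ h⟩
  loopless := ⟨by
    rintro (_ | x) h
    · exact h
    · exact G.loopless.irrefl x h⟩

variable {u v : V}

@[simp] theorem ear_adj_some_some (x y : V) : (G.ear u v).Adj (some x) (some y) ↔ G.Adj x y :=
  Iff.rfl

@[simp] theorem ear_adj_some_none (x : V) : (G.ear u v).Adj (some x) none ↔ x = u ∨ x = v :=
  Iff.rfl

@[simp] theorem ear_adj_none_some (x : V) : (G.ear u v).Adj none (some x) ↔ x = u ∨ x = v :=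
  Iff.rfl

theorem ear_swap : G.ear u v = G.ear v u := by
  ext (_ | x) (_ | y) <;> simp [or_comm]

theorem ear_connected (hG : G.Connected) : (G.ear u v).Connected := by
  have hr (x : V) : (G.ear u v).Reachable (some x) none :=
    ((hG.preconnected x u).map ⟨some, fun h ↦ h⟩).trans
      (Adj.reachable (by simp : (G.ear u v).Adj (some u) none))
  have hr' (x : Option V) : (G.ear u v).Reachable x none := by
    cases x with
    | none => exact Reachable.refl _
    | some x => exact hr x
  exact ⟨fun x y ↦ (hr' x).trans (hr' y).symm⟩

theorem ncard_edgeSet_ear [Finite V] (huv : u ≠ v) :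
    (G.ear u v).edgeSet.ncard = G.edgeSet.ncard + 2 := by
  have h : (G.ear u v).edgeSet =
      Sym2.map some '' G.edgeSet ∪ {s(none, some u), s(none, some v)} := by
    ext e
    induction e with | _ a b => ?_
    simp only [mem_edgeSet, Set.mem_union, Set.mem_image, Set.mem_insert_iff,
      Set.mem_singleton_iff, Sym2.eq_iff]
    constructor
    · intro h
      rcases a with _ | a <;> rcases b with _ | b
      · exact absurd rfl h.ne
      · simpa using Or.inr h
      · simpa using Or.inr h
      · exact Or.inl ⟨s(a, b), h, rfl⟩
    · rintro (⟨e, he, h⟩ | h)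
      · induction e with | _ x y => ?_
        rw [Sym2.map_mk, Sym2.eq_iff] at h
        rcases h with ⟨rfl, rfl⟩ | ⟨rfl, rfl⟩
        · exact he
        · exact G.symm.symm _ _ he
      · rcases h with (⟨rfl, rfl⟩ | ⟨rfl, rfl⟩) | ⟨rfl, rfl⟩ | ⟨rfl, rfl⟩ <;> simp
  rw [h, Set.ncard_union_eq, Set.ncard_image_of_injective _
    (Sym2.map.injective (Option.some_injective V)), Set.ncard_pair]
  · simpa [Sym2.eq_iff] using huv
  · rw [Set.disjoint_left]
    rintro _ ⟨e, -, rfl⟩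
    induction e with | _ x y => ?_
    simp

namespace IsLinearAt

theorem ear_of_ne {x : V} {k : ℕ} {f : ℕ → V} (h : G.IsLinearAt x k f) (hu : x ≠ u)
    (hv : x ≠ v) : (G.ear u v).IsLinearAt (some x) k (some ∘ f) where
  adj_iff := by
    rintro (_ | y)
    · simp [hu, hv]
    · simp [h.adj_iff]
  inj i hi j hj hij := h.inj i hi j hj (Option.some_injective _ hij)
  path i hi j hj := h.path i hi j hj

/-- Within the link of `u` the new vertex is adjacent only to the end `f 0`, so it extends the path
at the front and shifts the old indices by one. -/
theorem ear_left {k : ℕ} {f : ℕ → V} (h : G.IsLinearAt u k f) (hv : f 0 = v) :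
    (G.ear u v).IsLinearAt (some u) (k + 1) (fun i ↦ i.casesOn none (some ∘ f)) := by
  have huv : f 0 ≠ u := (h.adj (Nat.zero_le k)).ne'
  subst hv
  refine ⟨?_, ?_, ?_⟩
  · rintro (_ | y)
    · simp only [ear_adj_some_none, true_or, true_iff]
      exact ⟨0, by omega, rfl⟩
    · rw [ear_adj_some_some, h.adj_iff]
      constructor
      · rintro ⟨i, hi, rfl⟩
        exact ⟨i + 1, by omega, rfl⟩
      · rintro ⟨_ | i, hi, hy⟩
        · exact absurd hy (by simp)
        · exact ⟨i, by omega, Option.some_injective _ hy⟩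
  · rintro (_ | i) hi (_ | j) hj hij
    · rfl
    · exact absurd hij (by simp)
    · exact absurd hij (by simp)
    · rw [h.inj i (by omega) j (by omega) (Option.some_injective _ hij)]
  · have key (j : ℕ) (hj : j ≤ k) : (f j = u ∨ f j = f 0) ↔ j = 0 := by
      constructor
      · rintro (e | e)
        · exact absurd e (h.adj hj).ne'
        · exact h.inj j hj 0 (by omega) e
      · rintro rfl
        exact Or.inr rfl
    rintro (_ | i) hi (_ | j) hj
    · exact iff_of_false (fun h ↦ h.ne rfl) (by omega)
    · exact (key j (by omega)).trans (by omega)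
    · exact (key i (by omega)).trans (by omega)
    · exact (h.path i (by omega) j (by omega)).trans (by omega)

theorem ear_none (huv : G.Adj u v) :
    (G.ear u v).IsLinearAt none 1 (fun i ↦ if i = 0 then some u else some v) where
  adj_iff := by
    rintro (_ | y)
    · simp only [SimpleGraph.irrefl, false_iff]
      rintro ⟨i, -, hi⟩
      split_ifs at hi
    · rw [ear_adj_none_some]
      constructor
      · rintro (rfl | rfl)
        · exact ⟨0, by omega, rfl⟩
        · exact ⟨1, by omega, rfl⟩
      · rintro ⟨i, -, hi⟩
        split_ifs at hi
        · exact Or.inl (Option.some_injective _ hi).symm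
        · exact Or.inr (Option.some_injective _ hi).symm
  inj i hi j hj h := by
    have := huv.ne
    have := huv.ne'
    split_ifs at h <;> first | omega | simp_all
  path i hi j hj := by
    have := huv.symm
    interval_cases i <;> interval_cases j <;> simp [huv, this]

end IsLinearAt

/-! ### Graphs attaining the bound -/

/-- The neighbours of the vertices of a locally linear annulus on twelve vertices: two 4-cycles
`0, …, 3` and `4, …, 7`, joined by a ring of triangles, and an ear on each edge of the first. -/
def annulusNeighbors : Fin 12 → List (Fin 12) :=
  ![[8, 1, 5, 4, 3, 11], [9, 2, 6, 5, 0, 8], [10, 3, 7, 6, 1, 9], [11, 0, 4, 7, 2, 10],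
    [5, 0, 3, 7], [4, 0, 1, 6], [5, 1, 2, 7], [6, 2, 3, 4], [0, 1], [1, 2], [2, 3], [3, 0]]

/-- The annulus with the neighbourhoods `annulusNeighbors`. -/
def annulus : SimpleGraph (Fin 12) where
  Adj x y := y ∈ annulusNeighbors x
  symm := ⟨by decide⟩
  loopless := ⟨by decide⟩

instance : DecidableRel annulus.Adj := fun x y ↦
  inferInstanceAs (Decidable (y ∈ annulusNeighbors x))

theorem annulus_isLinearAt (v : Fin 12) : annulus.IsLinearAt v
    ((annulusNeighbors v).length - 1) (fun i ↦ (annulusNeighbors v).getD i 0) where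
  adj_iff := by revert v; decide
  inj := by revert v; decide
  path := by revert v; decide

theorem annulus_connected : annulus.Connected := by
  have h (x : Fin 12) : annulus.Reachable x 0 := by
    induction x using WellFoundedLT.induction with
    | ind x ih =>
      by_cases hx : x = 0
      · rw [hx]
      · have : ∀ x : Fin 12, x ≠ 0 → ∃ y < x, annulus.Adj x y := by decide
        obtain ⟨y, hy, ha⟩ := this x hx
        exact ha.reachable.trans (ih y hy)
  exact ⟨fun x y ↦ (h x).trans (h y).symm⟩

theorem ncard_edgeSet_annulus : annulus.edgeSet.ncard = 24 := by
  have h := sum_degrees_eq_twice_card_edges annulus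
  have h2 : ∑ v, annulus.degree v = 48 := by decide
  rw [← coe_edgeFinset, Set.ncard_coe_finset]
  omega

/-- There is a connected locally linear graph of order `n` with `2 * n` edges and a boundary edge, in which the
neighbours of some set `A` of vertices lie in a set that is not larger than `A`. -/
theorem exists_annulus (n : ℕ) (hn : 12 ≤ n) :
    ∃ (V : Type) (_ : Fintype V) (_ : DecidableEq V) (G : SimpleGraph V),
      Fintype.card V = n ∧ G.Connected ∧ (∀ v, ∃ k f, G.IsLinearAt v k f) ∧
      G.edgeSet.ncard = 2 * n ∧ ∃ A C : Finset V, A.Nonempty ∧ C.card ≤ A.card ∧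
      (∀ a ∈ A, ∀ c, G.Adj a c → c ∈ C) ∧ (∃ z, z ∉ A ∧ z ∉ C) ∧
      ∃ u v, u ∉ A ∧ v ∉ A ∧ (∃ k f, G.IsLinearAt u k f ∧ f 0 = v) ∧
        ∃ k f, G.IsLinearAt v k f ∧ f 0 = u := by
  induction n, hn using Nat.le_induction with
  | base =>
    -- The ears `8, …, 11` have all their neighbours on the cycle `0, …, 3`. The edge between `4`
    -- and `5` lies on the other boundary cycle and is free for further ears.
    refine ⟨Fin 12, inferInstance, inferInstance, annulus, rfl, annulus_connected,
      fun v ↦ ⟨_, _, annulus_isLinearAt v⟩, ncard_edgeSet_annulus, {8, 9, 10, 11}, {0, 1, 2, 3},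
      by decide, by decide, by decide, ⟨4, by decide⟩, 4, 5, by decide, by decide,
      ⟨_, _, annulus_isLinearAt 4, rfl⟩, ⟨_, _, annulus_isLinearAt 5, rfl⟩⟩
  | succ n hn ih =>
    obtain ⟨V, _, _, G, hV, hG, hl, hm, A, C, hA, hC, hAC, ⟨z, hzA, hzC⟩, u, v, hu, hv,
      ⟨k, f, hf, hfv⟩, l, g, hg, hgu⟩ := ih
    have huv : G.Adj u v := hfv ▸ hf.adj (Nat.zero_le k)
    -- The next ear will go on the edge from `u` to the new vertex: each is the first vertex in the
    -- other's link, and neither is in the image of `A`.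
    refine ⟨Option V, inferInstance, inferInstance, G.ear u v, by simp [hV], ear_connected hG,
      ?_, by rw [ncard_edgeSet_ear huv.ne, hm]; ring, A.map .some, C.map .some, by simpa,
      by simpa, ?_, ⟨some z, by simpa, by simpa⟩, some u, none, by simpa, by simp,
      ⟨_, _, hf.ear_left hfv, rfl⟩, ⟨_, _, IsLinearAt.ear_none huv, rfl⟩⟩
    · rintro (_ | x)
      · exact ⟨_, _, IsLinearAt.ear_none huv⟩
      · by_cases hxu : x = u
        · subst hxu
          exact ⟨_, _, hf.ear_left hfv⟩
        · by_cases hxv : x = v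
          · subst hxv
            rw [ear_swap]
            exact ⟨_, _, hg.ear_left hgu⟩
          · obtain ⟨_, _, h⟩ := hl x
            exact ⟨_, _, h.ear_of_ne hxu hxv⟩
    · intro a ha c hac
      obtain ⟨a, ha', rfl⟩ := Finset.mem_map.1 ha
      rcases c with _ | c
      · rcases hac with rfl | rfl
        · exact absurd ha' hu
        · exact absurd ha' hv
      · exact Finset.mem_map_of_mem _ (hAC a ha' c hac)

/-! ### Transport to `Fin n` and conclusion -/

theorem IsLinearAt.map_iso {W : Type*} {H : SimpleGraph W} (e : G ≃g H) {v : V} {k : ℕ}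
    {f : ℕ → V} (h : G.IsLinearAt v k f) : H.IsLinearAt (e v) k (e ∘ f) where
  adj_iff y := by
    obtain ⟨x, rfl⟩ := e.surjective y
    rw [e.map_adj_iff, h.adj_iff]
    simp
  inj i hi j hj hij := h.inj i hi j hj (e.injective hij)
  path i hi j hj := e.map_adj_iff.trans (h.path i hi j hj)

theorem Iso.isHamiltonian {W : Type*} {H : SimpleGraph W} [Fintype V] [DecidableEq V]
    [Fintype W] [DecidableEq W] (e : G ≃g H) (h : G.IsHamiltonian) : H.IsHamiltonian := by
  intro hW
  obtain ⟨a, p, hp⟩ := h (by rwa [e.card_eq])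
  exact ⟨_, p.map e.toHom, hp.map e.bijective⟩

end SimpleGraph

theorem two_mul_mem_nonhamiltonianLocallyLinearSizes (n : ℕ) (hn : 12 ≤ n) :
    2 * n ∈ nonhamiltonianLocallyLinearSizes n := by
  obtain ⟨V, _, _, G, hV, hG, hl, hm, A, C, hA, hC, hAC, ⟨z, hzA, hzC⟩, -⟩ :=
    SimpleGraph.exists_annulus n hn
  let e : V ≃ Fin n := Fintype.equivFinOfCardEq hV
  let i : G ≃g G.map e.toEmbedding := SimpleGraph.Iso.map e G
  refine ⟨G.map e.toEmbedding, i.connected_iff.1 hG,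
    SimpleGraph.isLocallyLinear_iff.2 fun w ↦ ?_, fun h ↦ ?_, ?_⟩
  · obtain ⟨v, rfl⟩ := i.surjective w
    obtain ⟨k, f, h⟩ := hl v
    exact ⟨k, _, h.map_iso i⟩
  · exact SimpleGraph.not_isHamiltonian_of_card_le hA hC hAC hzA hzC (i.symm.isHamiltonian h)
  · rw [← hm]
    exact (Nat.card_congr i.mapEdgeSet).symm

theorem theorem2 :
    (∀ n : ℕ, 12 ≤ n → IsLeast (nonhamiltonianLocallyLinearSizes n) (2 * n)) ∧
    (∀ n : ℕ, 3 ≤ n → ∀ m ∈ nonhamiltonianLocallyLinearSizes n, 2 * n ≤ m) := by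
  have h (n : ℕ) (hn : 3 ≤ n) (m : ℕ) (hm : m ∈ nonhamiltonianLocallyLinearSizes n) :
      2 * n ≤ m := by
    obtain ⟨G, hG, hl, hH, rfl⟩ := hm
    simpa using hl.two_mul_card_le hG (by simpa using hn) hH
  exact ⟨fun n hn ↦ ⟨two_mul_mem_nonhamiltonianLocallyLinearSizes n hn,
    fun m hm ↦ h n (by omega) m hm⟩, h⟩
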